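/- For a set $S\subseteq\mathbb{R}^2$, let $h(S)\in\mathbb{N}_0\cup\{\infty\}$ be the maximum number of vertices of a convex polytope $P$ that is empty in $S$, meaning that all vertices of $P$ belong to $S$ and $P$ contains no point of $S$ other than its vertices (with $h(S)=\infty$ if there are such polytopes with arbitrarily many vertices). Let the Helly number $H(S)$ be the smallest positive integer $N$ such that, for every finite family $\mathcal{F}$ of convex sets in $\mathbb{R}^2$, if the intersection of any $N$ or fewer members of $\mathcal{F}$ contains a point of $S$, then $\bigcap\mathcal{F}$ contains a point of $S$ (with $H(S)=\infty$ if there is no such $N$). For a real number $\alpha>1$ let $L(\alpha)=\{\alpha^n : n\in\mathbb{N}_0\}^2\subseteq\mathbb{R}^2$. Then $$h(L(\alpha))=H(L(\alpha))=5\quad\text{for every } \alpha\ge 2,$$ $$h(L(\alpha))=H(L(\alpha))=7\quad\text{for every } \alpha\in\left[\tfrac{1+\sqrt5}{2},2\right).$$ In particular, $H(\{2^n : n\in\mathbb{N}_0\}^2)=5$. -/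

import Mathlib

/-- The exponential lattice `L(α) = {α ^ n : n ∈ ℕ₀}²` in the plane. -/
def expLattice (α : ℝ) : Set (ℝ × ℝ) :=
  Set.range (fun n : ℕ => α ^ n) ×ˢ Set.range (fun n : ℕ => α ^ n)

/-- `P` is a convex polytope (the convex hull of a finite set) whose vertices, that is, extreme
points, belong to `S`, and `P` contains no points of `S` other than its vertices. -/
def IsEmptyPolytope {E : Type*} [AddCommGroup E] [Module ℝ E] (S P : Set E) : Prop :=
  (∃ V : Set E, V.Finite ∧ P = convexHull ℝ V) ∧
    P.extremePoints ℝ ⊆ S ∧ P ∩ S ⊆ P.extremePoints ℝ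

/-- `h(S)`: the maximum number of vertices of an empty polytope in `S`,
and `⊤` if there are such polytopes with arbitrarily many vertices. -/
noncomputable def maxEmptyVertices {E : Type*} [AddCommGroup E] [Module ℝ E]
    (S : Set E) : ℕ∞ :=
  ⨆ (P : Set E) (_ : IsEmptyPolytope S P), (P.extremePoints ℝ).encard

/-- The Helly property of `S` for `N`: for every finite family `F` of convex sets, if the
intersection of any `N` or fewer members of `F` contains a point of `S`, then so does the
intersection of all members of `F`. -/
def HasHellyProperty {E : Type*} [AddCommGroup E] [Module ℝ E] (S : Set E) (N : ℕ) : Prop :=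
  ∀ F : Finset (Set E), (∀ C ∈ F, Convex ℝ C) →
    (∀ G : Finset (Set E), G ⊆ F → G.card ≤ N → (⋂₀ (G : Set (Set E)) ∩ S).Nonempty) →
      (⋂₀ (F : Set (Set E)) ∩ S).Nonempty

/-- The Helly number `H(S)`: the smallest positive integer `N` with the Helly property of `S`,
and `⊤` if there is none. -/
noncomputable def hellyNumber {E : Type*} [AddCommGroup E] [Module ℝ E] (S : Set E) : ℕ∞ :=
  ⨅ (N : ℕ) (_ : 0 < N ∧ HasHellyProperty S N), (N : ℕ∞)

/-! Both numbers count the same objects. If every bounded region holds finitely many points of `S`,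
a minimal family of convex sets with no common point in `S` yields an empty polytope with as many
vertices (`exists_isEmptyVertexSet_of_sInter_empty`). Conversely, the hulls of a vertex set minus
one vertex each show that the Helly number is at least the vertex count. It remains to find the
largest empty polygon.

Points are recorded by their exponents, and all integer exponents are allowed, so that the
projective map `(x, y) ↦ (1/x, y/x)` acts beside the swap of coordinates. Emptiness forces more than
four points to be all ascending or all descending, and the symmetries reduce this to the descending
case. Let the chord `A x + B y = C` join the upper left point `p` to the lower right point `r`. A
point `n` columns left of `r` has `A x < C / α ^ n`, and one `n` rows below `p` has `B y < C / α ^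
n`. Hence a point above the chord, outside the row of `p` and the column of `r`, is impossible if `2
/ α ≤ 1`, and there is at most one if `1 / α + 1 / α ^ 2 ≤ 1`, which is the golden ratio condition.
Two points below the chord span a corner above it, so the same estimates allow one, respectively
two, of them. The row of `p` and the column of `r` contribute at most four points in all, `p` and
`r` included. The bounds are thus `4 + 1 + 0` and `4 + 2 + 1`, and explicit polygons attain them. -/

/-- `V` is the vertex set of an empty polytope in `S`: a finite subset of `S` in convex position
whose convex hull contains no further points of `S`. -/
structure IsEmptyVertexSet {E : Type*} [AddCommGroup E] [Module ℝ E] (S V : Set E) : Prop where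
  finite : V.Finite
  subset : V ⊆ S
  inter_subset : convexHull ℝ V ∩ S ⊆ V
  notMem_convexHull : ∀ v ∈ V, v ∉ convexHull ℝ (V \ {v})

/-! ### Empty polytopes and Helly numbers of discrete sets -/

section VertexSets

variable {E : Type*}

theorem Convex.mem_of_add_smul_eq [AddCommGroup E] [Module ℝ E] {C : Set E} (hC : Convex ℝ C)
    {x y v : E} (hx : x ∈ C) (hy : y ∈ C) {a b : ℝ} (ha : 0 ≤ a) (hb : 0 ≤ b) (hab : 0 < a + b)
    (h : (a + b) • v = a • x + b • y) : v ∈ C := by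
  have hv : v = (a / (a + b)) • x + (b / (a + b)) • y := by
    rw [div_eq_inv_mul, div_eq_inv_mul, mul_smul, mul_smul, ← smul_add, ← h,
      inv_smul_smul₀ hab.ne']
  rw [hv]
  exact hC hx hy (by positivity) (by positivity) (by field_simp)

/-- Every point of the hull lies on a segment from `v` to the hull of the other vertices. If two
such points different from `v` averaged to `v`, solving for `v` would put it into that smaller hull.
So the hull stays convex when `v` is removed. -/
theorem IsEmptyVertexSet.extremePoints_convexHull [AddCommGroup E] [Module ℝ E] {S V : Set E}
    (h : IsEmptyVertexSet S V) : (convexHull ℝ V).extremePoints ℝ = V := by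
  refine Set.Subset.antisymm extremePoints_convexHull_subset fun v hv => ?_
  rw [(convex_convexHull ℝ V).mem_extremePoints_iff_mem_sdiff_convexHull_sdiff]
  refine ⟨subset_convexHull ℝ V hv, fun hmem => ?_⟩
  rcases (V \ {v}).eq_empty_or_nonempty with hemp | hne
  · have hV : V ⊆ {v} := Set.sdiff_eq_empty.1 hemp
    have : convexHull ℝ V ⊆ {v} := convexHull_min hV (convex_singleton v)
    rw [Set.sdiff_eq_empty.2 this] at hmem
    simp at hmem
  · obtain ⟨c, hc⟩ := hne
    have hconv : Convex ℝ (convexHull ℝ V \ {v}) := by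
      rw [convex_iff_forall_pos]
      have key : ∀ x ∈ convexHull ℝ V, ∃ y ∈ convexHull ℝ (V \ {v}), x ∈ segment ℝ v y := by
        intro x hx
        have hins : V = insert v (V \ {v}) := by simp [Set.insert_eq_of_mem hv]
        rw [hins, convexHull_insert ⟨c, hc⟩, convexJoin_singleton_left] at hx
        simpa using hx
      intro x hx y hy a b ha hb hab
      refine ⟨convex_convexHull ℝ V hx.1 hy.1 ha.le hb.le hab, fun heq => ?_⟩
      obtain ⟨x', hx', a1, b1, ha1, hb1, hab1, rfl⟩ := key x hx.1
      obtain ⟨y', hy', a2, b2, ha2, hb2, hab2, rfl⟩ := key y hy.1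
      have hb1' : 0 < b1 := by
        rcases hb1.eq_or_lt with h0 | h0
        · exact absurd (by simp [← h0, show a1 = 1 by linarith]) hx.2
        · exact h0
      have hc0 : 0 < a * b1 + b * b2 := by positivity
      refine h.notMem_convexHull v hv ?_
      have h1 : (a * b1 + b * b2) • v = (a * b1) • x' + (b * b2) • y' := by
        have h2 : a • (a1 • v + b1 • x') + b • (a2 • v + b2 • y') = v := heq
        have h3 : a * b1 + b * b2 = 1 - (a * a1 + b * a2) := by
          rw [show a1 = 1 - b1 by linarith, show a2 = 1 - b2 by linarith]; linarith
        rw [h3, sub_smul, one_smul]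
        nth_rewrite 1 [← h2]
        module
      exact (convex_convexHull ℝ _).mem_of_add_smul_eq hx' hy' (by positivity) (by positivity)
        hc0 h1
    exact (convexHull_min subset_rfl hconv hmem).2 rfl

theorem IsEmptyVertexSet.isEmptyPolytope [AddCommGroup E] [Module ℝ E] {S V : Set E}
    (h : IsEmptyVertexSet S V) : IsEmptyPolytope S (convexHull ℝ V) := by
  refine ⟨⟨V, h.finite, rfl⟩, ?_, ?_⟩ <;> rw [h.extremePoints_convexHull]
  exacts [h.subset, h.inter_subset]

theorem IsEmptyVertexSet.encard_le [AddCommGroup E] [Module ℝ E] {S V : Set E}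
    (h : IsEmptyVertexSet S V) : V.encard ≤ maxEmptyVertices S := by
  have := le_iSup₂ (f := fun (P : Set E) (_ : IsEmptyPolytope S P) => (P.extremePoints ℝ).encard)
    (convexHull ℝ V) h.isEmptyPolytope
  rwa [h.extremePoints_convexHull] at this

theorem IsEmptyPolytope.isEmptyVertexSet [NormedAddCommGroup E] [NormedSpace ℝ E] {S P : Set E}
    (h : IsEmptyPolytope S P) : IsEmptyVertexSet S (P.extremePoints ℝ) := by
  obtain ⟨⟨V, hV, rfl⟩, hS, hP⟩ := h
  have hfin : ((convexHull ℝ V).extremePoints ℝ).Finite :=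
    hV.subset extremePoints_convexHull_subset
  have hhull : convexHull ℝ ((convexHull ℝ V).extremePoints ℝ) = convexHull ℝ V := by
    have := closure_convexHull_extremePoints (hV.isCompact_convexHull ℝ) (convex_convexHull ℝ V)
    rwa [(hfin.isClosed_convexHull ℝ).closure_eq] at this
  refine ⟨hfin, hS, by rwa [hhull], fun v hv hmem => ?_⟩
  have h1 := ((convex_convexHull ℝ V).mem_extremePoints_iff_mem_sdiff_convexHull_sdiff.1 hv).2
  exact h1 (convexHull_mono (Set.sdiff_subset_sdiff_left extremePoints_subset) hmem)

theorem maxEmptyVertices_le [NormedAddCommGroup E] [NormedSpace ℝ E] {S : Set E} {k : ℕ∞}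
    (h : ∀ V : Set E, IsEmptyVertexSet S V → V.encard ≤ k) : maxEmptyVertices S ≤ k :=
  iSup₂_le fun _ hP => h _ hP.isEmptyVertexSet

/-- The test family consists of the hulls of `V` minus one vertex. Fewer than `|V|` of them share an
omitted vertex, whereas a point of `S` common to all would be a vertex lying in the hull of the
others. -/
theorem IsEmptyVertexSet.le_of_hasHellyProperty [AddCommGroup E] [Module ℝ E] {S V : Set E}
    (h : IsEmptyVertexSet S V) {N : ℕ} (hN : HasHellyProperty S N) : V.encard ≤ N := by
  classical
  by_contra! hlt
  obtain ⟨W, rfl⟩ := h.finite.exists_finset_coe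
  rw [Set.encard_coe_eq_coe_finsetCard, Nat.cast_lt] at hlt
  obtain ⟨x, hx, hxS⟩ := hN (W.image fun v => convexHull ℝ ((W : Set E) \ {v}))
    (by simp +contextual [convex_convexHull]) (by
      intro G hG hcard
      obtain ⟨U, hUW, rfl⟩ := Finset.subset_image_iff.1 hG
      have hinj : Set.InjOn (fun v => convexHull ℝ ((W : Set E) \ {v})) W := by
        intro v hv w hw hvw
        by_contra hne
        refine h.notMem_convexHull v hv ?_
        rw [show convexHull ℝ ((W : Set E) \ {v}) = _ from hvw]
        exact subset_convexHull ℝ _ ⟨hv, hne⟩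
      rw [Finset.card_image_of_injOn (hinj.mono hUW)] at hcard
      obtain ⟨v, hvW, hvU⟩ := Finset.exists_mem_notMem_of_card_lt_card (hcard.trans_lt hlt)
      refine ⟨v, ?_, h.subset hvW⟩
      simp only [Finset.coe_image, Set.sInter_image, Set.mem_iInter]
      intro u hu
      refine subset_convexHull ℝ _ ⟨hvW, ?_⟩
      rintro rfl
      exact hvU hu)
  simp only [Finset.coe_image, Set.sInter_image, Set.mem_iInter] at hx
  have hWne : W.Nonempty := Finset.card_pos.1 (by omega)
  obtain ⟨w, hw⟩ := hWne
  have hxW : x ∈ (W : Set E) :=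
    h.inter_subset ⟨convexHull_mono Set.sdiff_subset (hx w hw), hxS⟩
  exact h.notMem_convexHull x hxW (hx x hxW)

/-- The anti-exchange property of the convex hull. -/
theorem mem_convexHull_of_exchange [AddCommGroup E] [Module ℝ E] {C : Set E} {x t : E}
    (hx : x ∈ convexHull ℝ (insert t C)) (ht : t ∈ convexHull ℝ (insert x C)) (hne : x ≠ t) :
    t ∈ convexHull ℝ C := by
  rcases C.eq_empty_or_nonempty with rfl | hC
  · simp at hx; exact absurd hx hne
  rw [convexHull_insert hC, convexJoin_singleton_left] at hx ht
  simp only [Set.mem_iUnion] at hx ht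
  obtain ⟨c, hc, a1, b1, ha1, hb1, hab1, rfl⟩ := hx
  obtain ⟨d, hd, a2, b2, ha2, hb2, hab2, heq⟩ := ht
  have hb1' : 0 < b1 := by
    rcases hb1.eq_or_lt with h0 | h0
    · exact absurd (by simp [← h0, show a1 = 1 by linarith]) hne
    · exact h0
  have hc0 : 0 < a2 * b1 + b2 := by
    rcases ha2.eq_or_lt with h0 | h0
    · rw [← h0] at hab2 ⊢; linarith
    · positivity
  have h1 : (a2 * b1 + b2) • t = (a2 * b1) • c + b2 • d := by
    have h3 : a2 * b1 + b2 = 1 - a2 * a1 := by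
      rw [show a1 = 1 - b1 by linarith, show a2 = 1 - b2 by linarith]; ring
    rw [h3, sub_smul, one_smul]
    nth_rewrite 1 [← heq]
    module
  exact (convex_convexHull ℝ _).mem_of_add_smul_eq hc hd (by positivity) hb2 hc0 h1

/-- A relatively convex proper subset of a finite set can be enlarged by one point to a relatively
convex subset. -/
theorem exists_insert_relConvex [AddCommGroup E] [Module ℝ E] {T A : Set E} (hT : T.Finite)
    (hAT : A ⊆ T) (hA : convexHull ℝ A ∩ T ⊆ A) (hne : A ≠ T) :
    ∃ t ∈ T, t ∉ A ∧ convexHull ℝ (insert t A) ∩ T ⊆ insert t A := by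
  obtain ⟨t0, ht0⟩ : (T \ A).Nonempty := Set.sdiff_nonempty.2 fun h => hne (hAT.antisymm h)
  -- Take `t` whose hull with `A` holds the fewest points of `T`. A further point `x` in it would
  -- generate the same trace on `T`, so `x` and `t` would each lie in the hull of `A` with the
  -- other, against anti-exchange.
  obtain ⟨t, ht, hmin⟩ := Set.exists_min_image (T \ A)
    (fun t => (convexHull ℝ (insert t A) ∩ T).ncard) (hT.subset Set.sdiff_subset) ⟨t0, ht0⟩
  refine ⟨t, ht.1, ht.2, fun x hx => ?_⟩
  by_contra hxt
  simp only [Set.mem_insert_iff, not_or] at hxt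
  have hsub : convexHull ℝ (insert x A) ⊆ convexHull ℝ (insert t A) :=
    convexHull_min (Set.insert_subset hx.1
      ((Set.subset_insert t A).trans (subset_convexHull ℝ _))) (convex_convexHull ℝ _)
  have htx : t ∈ convexHull ℝ (insert x A) ∩ T := by
    have heq := Set.eq_of_subset_of_ncard_le (Set.inter_subset_inter_left T hsub)
      (hmin x ⟨hx.2, hxt.2⟩) (hT.subset Set.inter_subset_right)
    rw [heq]
    exact ⟨subset_convexHull ℝ _ (Set.mem_insert t A), ht.1⟩
  exact ht.2 (hA ⟨mem_convexHull_of_exchange hx.1 htx.1 hxt.1, ht.1⟩)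

/-- The traces `K i ∩ T` are enlarged to a maximal family of relatively convex sets `A i` with empty
intersection. Adding one admissible point `t i` to `A i` must then create a common point, so `t i`
lies in every other `A j`. These points are the vertices: a point of `T` in their hull misses some
`A i`, and is therefore `t i`. -/
theorem exists_isEmptyVertexSet_of_sInter_empty [AddCommGroup E] [Module ℝ E] {ι : Type*}
    [Finite ι] {S T : Set E} (hTS : T ⊆ S) (hT : T.Finite) (hST : convexHull ℝ T ∩ S ⊆ T)
    (K : ι → Set E) (hK : ∀ i, Convex ℝ (K i)) (hemp : ∀ x ∈ T, ∃ i, x ∉ K i)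
    (hmin : ∀ i, ∃ x ∈ T, ∀ j, j ≠ i → x ∈ K j) :
    ∃ V : Set E, IsEmptyVertexSet S V ∧ V.encard = ENat.card ι := by
  classical
  let 𝒜 : Set (ι → Set E) := {A | (∀ i, A i ⊆ T) ∧ (∀ i, convexHull ℝ (A i) ∩ T ⊆ A i) ∧
    (∀ i, K i ∩ T ⊆ A i) ∧ ∀ x ∈ T, ∃ i, x ∉ A i}
  have h𝒜fin : 𝒜.Finite := by
    refine (Set.Finite.pi' (t := fun _ : ι => 𝒫 T) fun _ => hT.powerset).subset ?_
    exact fun A hA i => hA.1 i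
  have h𝒜ne : 𝒜.Nonempty := by
    refine ⟨fun i => K i ∩ T, fun i => Set.inter_subset_right, fun i x hx => ?_,
      fun i => subset_rfl, fun x hx => ?_⟩
    · exact ⟨convexHull_min Set.inter_subset_left (hK i) hx.1, hx.2⟩
    · obtain ⟨i, hi⟩ := hemp x hx
      exact ⟨i, fun h => hi h.1⟩
  obtain ⟨A, hAmax⟩ := h𝒜fin.exists_maximal h𝒜ne
  obtain ⟨hAT, hAc, hAK, hAe⟩ := hAmax.prop
  have hstep : ∀ i, ∃ t ∈ T, t ∉ A i ∧ convexHull ℝ (insert t (A i)) ∩ T ⊆ insert t (A i) ∧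
      ∀ j, j ≠ i → t ∈ A j := by
    intro i
    -- Otherwise the point lying in all `K j` with `j ≠ i` would be common to all the `A j`.
    have hne : A i ≠ T := by
      intro heq
      obtain ⟨x, hxT, hx⟩ := hmin i
      obtain ⟨j, hj⟩ := hAe x hxT
      rcases eq_or_ne j i with rfl | hji
      · exact hj (heq ▸ hxT)
      · exact hj (hAK j ⟨hx j hji, hxT⟩)
    obtain ⟨t, htT, htA, htc⟩ := exists_insert_relConvex hT (hAT i) (hAc i) hne
    refine ⟨t, htT, htA, htc, fun j hji => ?_⟩
    by_contra htj
    have hup : Function.update A i (insert t (A i)) ∈ 𝒜 := by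
      refine ⟨fun k => ?_, fun k => ?_, fun k => ?_, fun x hx => ?_⟩
      · rcases eq_or_ne k i with rfl | hk
        · simpa using Set.insert_subset htT (hAT k)
        · simpa [hk] using hAT k
      · rcases eq_or_ne k i with rfl | hk
        · simpa using htc
        · simpa [hk] using hAc k
      · rcases eq_or_ne k i with rfl | hk
        · simpa using (hAK k).trans (Set.subset_insert _ _)
        · simpa [hk] using hAK k
      · rcases eq_or_ne x t with rfl | hxt
        · exact ⟨j, by simpa [hji] using htj⟩
        · obtain ⟨k, hk⟩ := hAe x hx
          refine ⟨k, ?_⟩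
          rcases eq_or_ne k i with rfl | hki
          · simpa [hxt] using hk
          · simpa [hki] using hk
    have hle : A ≤ Function.update A i (insert t (A i)) := by
      intro k
      rcases eq_or_ne k i with rfl | hk
      · simp
      · simp [hk]
    have := hAmax.le_of_ge hup hle i
    simp only [Function.update_self] at this
    exact htA (this (Set.mem_insert t _))
  choose t htT htA htc htj using hstep
  have hinj : Function.Injective t := by
    intro i j hij
    by_contra hne
    exact htA i (hij ▸ htj j i hne)
  refine ⟨Set.range t, ⟨Set.finite_range t, ?_, ?_, ?_⟩, ?_⟩
  · rintro _ ⟨i, rfl⟩; exact hTS (htT i)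
  · rintro x ⟨hx, hxS⟩
    have hxT : x ∈ T :=
      hST ⟨convexHull_mono (by rintro _ ⟨i, rfl⟩; exact htT i) hx, hxS⟩
    obtain ⟨i, hi⟩ := hAe x hxT
    have hsub : Set.range t ⊆ insert (t i) (A i) := by
      rintro _ ⟨j, rfl⟩
      rcases eq_or_ne i j with rfl | hij
      · exact Set.mem_insert _ _
      · exact Set.mem_insert_of_mem _ (htj j i hij)
    rcases htc i ⟨convexHull_mono hsub hx, hxT⟩ with h | h
    · exact ⟨i, h.symm⟩
    · exact absurd h hi
  · rintro _ ⟨i, rfl⟩ hmem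
    refine htA i (hAc i ⟨convexHull_mono ?_ hmem, htT i⟩)
    rintro _ ⟨⟨j, rfl⟩, hj⟩
    exact htj j i (by rintro rfl; exact hj rfl)
  · rw [← Set.image_univ, hinj.encard_image, Set.encard_univ]

/-- In a minimal subfamily without common point in `S`, each member has a witness lying in all the
others. The finite ground set is `S` within the hull of the witnesses. -/
theorem hasHellyProperty_of_encard_le [NormedAddCommGroup E] [NormedSpace ℝ E] {S : Set E}
    (hS : ∀ B : Set E, Bornology.IsBounded B → (S ∩ B).Finite) {k : ℕ}
    (h : ∀ V : Set E, IsEmptyVertexSet S V → V.encard ≤ k) : HasHellyProperty S k := by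
  classical
  intro F hF hsub
  by_contra hne
  obtain ⟨G, hG, hGmin⟩ := (F.powerset.filter
    fun G : Finset (Set E) => ¬ (⋂₀ (G : Set (Set E)) ∩ S).Nonempty).exists_minimal
    ⟨F, by simpa using hne⟩
  simp only [Finset.mem_filter, Finset.mem_powerset] at hG hGmin
  have hcard : k < G.card := by
    by_contra! hle
    exact hG.2 (hsub G hG.1 hle)
  have hex : ∀ C : G, ∃ x ∈ S, ∀ D : G, D ≠ C → x ∈ (D : Set E) := by
    intro C
    by_contra hno
    have hle : G ≤ G.erase C := hGmin (y := G.erase C) ⟨(G.erase_subset _).trans hG.1, by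
      rintro ⟨x, hx, hxS⟩
      refine hno ⟨x, hxS, fun D hD => hx D ?_⟩
      simp only [Finset.coe_erase, Set.mem_sdiff, Finset.mem_coe, Set.mem_singleton_iff]
      exact ⟨D.2, fun h => hD (Subtype.ext h)⟩⟩ (G.erase_subset _)
    simpa using hle C.2
  choose s hsS hs using hex
  have hbd : Bornology.IsBounded (convexHull ℝ (Set.range s)) :=
    isBounded_convexHull.2 (Set.finite_range s).isBounded
  obtain ⟨V, hV, hVcard⟩ := exists_isEmptyVertexSet_of_sInter_empty (ι := G)
    (S := S) (T := S ∩ convexHull ℝ (Set.range s)) Set.inter_subset_left (hS _ hbd)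
    (fun x hx => ⟨hx.2, convexHull_min Set.inter_subset_right (convex_convexHull ℝ _) hx.1⟩)
    (fun C => C) (fun C => hF C (hG.1 C.2))
    (fun x hx => by
      by_contra! hall
      exact hG.2 ⟨x, fun C hC => hall ⟨C, hC⟩, hx.1⟩)
    (fun C => ⟨s C, ⟨hsS C, subset_convexHull ℝ _ ⟨C, rfl⟩⟩, fun D hD => hs C D hD⟩)
  have := h V hV
  rw [hVcard] at this
  simp only [ENat.card_eq_coe_fintype_card, Fintype.card_coe, Nat.cast_le] at this
  omega

theorem maxEmptyVertices_and_hellyNumber_eq [NormedAddCommGroup E] [NormedSpace ℝ E] {S : Set E}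
    (hS : ∀ B : Set E, Bornology.IsBounded B → (S ∩ B).Finite) {k : ℕ} (hk : 0 < k)
    (hle : ∀ V : Set E, IsEmptyVertexSet S V → V.encard ≤ k)
    (hex : ∃ V : Set E, IsEmptyVertexSet S V ∧ V.encard = k) :
    maxEmptyVertices S = k ∧ hellyNumber S = k := by
  obtain ⟨V, hV, hVk⟩ := hex
  refine ⟨le_antisymm (maxEmptyVertices_le hle) (hVk ▸ hV.encard_le), le_antisymm ?_ ?_⟩
  · exact iInf₂_le_of_le k ⟨hk, hasHellyProperty_of_encard_le hS hle⟩ le_rfl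
  · exact le_iInf₂ fun N hN => hVk ▸ hV.le_of_hasHellyProperty hN.2

end VertexSets

/-! ### Integer exponents, projective symmetry and monotonicity -/

section ExponentSets

/-- The point with exponents `w` is a convex combination of the points with exponents
`p`, `q`, `r`. -/
def ExpCombination (α : ℝ) (p q r w : ℤ × ℤ) : Prop :=
  ∃ a b c : ℝ, 0 ≤ a ∧ 0 ≤ b ∧ 0 ≤ c ∧ a + b + c = 1 ∧
    a * α ^ p.1 + b * α ^ q.1 + c * α ^ r.1 = α ^ w.1 ∧
    a * α ^ p.2 + b * α ^ q.2 + c * α ^ r.2 = α ^ w.2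

/-- The points with exponents in `W` are in convex position, and no triangle spanned by them
contains another point of the exponential lattice with integer exponents. -/
def IsEmptyExponents (α : ℝ) (W : Finset (ℤ × ℤ)) : Prop :=
  ∀ p ∈ W, ∀ q ∈ W, ∀ r ∈ W, ∀ w, ExpCombination α p q r w → w = p ∨ w = q ∨ w = r

/-- The action on exponents of the projective map `(x, y) ↦ (x⁻¹, x⁻¹ * y)`. -/
def projExp (p : ℤ × ℤ) : ℤ × ℤ := (-p.1, p.2 - p.1)

theorem projExp_projExp (p : ℤ × ℤ) : projExp (projExp p) = p := by
  simp [projExp]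

theorem projExp_injective : Function.Injective projExp :=
  Function.LeftInverse.injective projExp_projExp

variable {α : ℝ} {W : Finset (ℤ × ℤ)} {p q r w : ℤ × ℤ}

theorem ExpCombination.swap (h : ExpCombination α p q r w) :
    ExpCombination α p.swap q.swap r.swap w.swap := by
  obtain ⟨a, b, c, ha, hb, hc, h1, h2, h3⟩ := h
  exact ⟨a, b, c, ha, hb, hc, h1, h3, h2⟩

theorem ExpCombination.map_projExp (hα : 0 < α) (h : ExpCombination α p q r w) :
    ExpCombination α (projExp p) (projExp q) (projExp r) (projExp w) := by
  obtain ⟨a, b, c, ha, hb, hc, h1, h2, h3⟩ := h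
  have hne := hα.ne'
  have hp := zpow_pos hα p.1
  have hq := zpow_pos hα q.1
  have hr := zpow_pos hα r.1
  have hw := zpow_pos hα w.1
  -- A projective map multiplies the weights by the denominators `α ^ p.1`, `α ^ q.1`, `α ^ r.1`;
  -- dividing by `α ^ w.1` normalises their sum.
  refine ⟨a * α ^ p.1 / α ^ w.1, b * α ^ q.1 / α ^ w.1, c * α ^ r.1 / α ^ w.1,
    by positivity, by positivity, by positivity, ?_, ?_, ?_⟩
  · rw [← add_div, ← add_div, h2, div_self hw.ne']
  · simp only [projExp, zpow_neg]
    field_simp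
    linarith
  · simp only [projExp, zpow_sub₀ hne]
    field_simp
    linarith

theorem IsEmptyExponents.swap (h : IsEmptyExponents α W) :
    IsEmptyExponents α (W.image Prod.swap) := by
  simp only [IsEmptyExponents, Finset.forall_mem_image]
  intro p hp q hq r hr w hw
  have e : ∀ v, w.swap = v → w = v.swap := by rintro _ rfl; simp
  exact (h p hp q hq r hr w.swap (by simpa using hw.swap)).imp (e p) (Or.imp (e q) (e r))

theorem IsEmptyExponents.image_projExp (hα : 0 < α) (h : IsEmptyExponents α W) :
    IsEmptyExponents α (W.image projExp) := by
  simp only [IsEmptyExponents, Finset.forall_mem_image]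
  intro p hp q hq r hr w hw
  have e : ∀ v, projExp w = v → w = projExp v := by rintro _ rfl; simp [projExp_projExp]
  exact (h p hp q hq r hr (projExp w) (by simpa [projExp_projExp] using hw.map_projExp hα)).imp
    (e p) (Or.imp (e q) (e r))

/-- A point of a triangle, seen on the horizontal line through the vertex `q`. -/
theorem expCombination_of_row {l x : ℝ} (hl : 0 ≤ l) (hl1 : l ≤ 1)
    (hx : (1 - l) * α ^ p.1 + l * α ^ r.1 = x) (hy : (1 - l) * α ^ p.2 + l * α ^ r.2 = α ^ q.2)
    (hw : w.2 = q.2)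
    (hb : x ≤ α ^ w.1 ∧ α ^ w.1 ≤ α ^ q.1 ∨ α ^ q.1 ≤ α ^ w.1 ∧ α ^ w.1 ≤ x) :
    ExpCombination α p q r w := by
  obtain ⟨s, hs, hs1, hsx⟩ : ∃ s : ℝ, 0 ≤ s ∧ s ≤ 1 ∧ (1 - s) * x + s * α ^ q.1 = α ^ w.1 := by
    rcases eq_or_ne x (α ^ q.1) with he | he
    · exact ⟨0, le_rfl, zero_le_one, by rcases hb with h | h <;> linarith⟩
    · have hne : α ^ q.1 - x ≠ 0 := sub_ne_zero.2 he.symm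
      refine ⟨(α ^ w.1 - x) / (α ^ q.1 - x), ?_, ?_, by field_simp; ring⟩
      · rcases hb with h | h
        · exact div_nonneg (by linarith) (by linarith)
        · exact div_nonneg_of_nonpos (by linarith) (by linarith)
      · rcases hb with h | h
        · rw [div_le_one (lt_of_le_of_ne (by linarith) hne.symm)]; linarith
        · rw [div_le_one_of_neg (lt_of_le_of_ne (by linarith) hne)]; linarith
  refine ⟨(1 - s) * (1 - l), s, (1 - s) * l, mul_nonneg (by linarith) (by linarith), hs,
    mul_nonneg (by linarith) hl, by ring, ?_, ?_⟩
  · rw [← hsx, ← hx]; ring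
  · rw [hw]; linear_combination (1 - s) * hy

/-- A horizontal line between two points meets the segment joining them. -/
theorem exists_row_mem_segment {y₁ y₂ y : ℝ} (h1 : y₁ ≤ y) (h2 : y ≤ y₂) :
    ∃ l : ℝ, 0 ≤ l ∧ l ≤ 1 ∧ (1 - l) * y₁ + l * y₂ = y := by
  rcases eq_or_lt_of_le (h1.trans h2) with h | h
  · exact ⟨0, le_rfl, zero_le_one, by linarith⟩
  · have : y₂ - y₁ ≠ 0 := by linarith
    refine ⟨(y - y₁) / (y₂ - y₁), div_nonneg (by linarith) (by linarith),
      div_le_one_of_le₀ (by linarith) (by linarith), by field_simp; ring⟩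

theorem IsEmptyExponents.row_adjacent (hα : 1 < α) (h : IsEmptyExponents α W) (hp : p ∈ W)
    (hq : q ∈ W) (hrow : p.2 = q.2) (hlt : p.1 < q.1) : q.1 = p.1 + 1 := by
  have hc : ExpCombination α p q p (p.1 + 1, p.2) := by
    refine expCombination_of_row (l := 0) le_rfl zero_le_one rfl (by simp [hrow]) hrow
      (Or.inl ⟨?_, zpow_le_zpow_right₀ hα.le (by simpa using hlt)⟩)
    simpa using zpow_le_zpow_right₀ hα.le (by omega : p.1 ≤ p.1 + 1)
  have := h p hp q hq p hp _ hc
  simp only [Prod.ext_iff] at this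
  omega

theorem IsEmptyExponents.col_adjacent (hα : 1 < α) (h : IsEmptyExponents α W) (hp : p ∈ W)
    (hq : q ∈ W) (hcol : p.1 = q.1) (hlt : p.2 < q.2) : q.2 = p.2 + 1 :=
  h.swap.row_adjacent hα (Finset.mem_image_of_mem _ hp) (Finset.mem_image_of_mem _ hq) hcol hlt

/-- `projExp` turns diagonals into rows and reverses their direction, whence the exchange of `p` and
`q`. -/
theorem IsEmptyExponents.diag_adjacent (hα : 1 < α) (h : IsEmptyExponents α W) (hp : p ∈ W)
    (hq : q ∈ W) (hdiag : q.1 - p.1 = q.2 - p.2) (hlt : p.1 < q.1) : q.1 = p.1 + 1 := by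
  have := (h.image_projExp (by linarith)).row_adjacent hα (Finset.mem_image_of_mem _ hq)
    (Finset.mem_image_of_mem _ hp) (by simp only [projExp]; omega)
    (by simp only [projExp]; omega)
  simp only [projExp] at this
  omega

/-- In an empty set, a point in a row strictly between two others is in a column weakly between
them. -/
theorem IsEmptyExponents.col_between (hα : 1 < α) (h : IsEmptyExponents α W) (hp : p ∈ W)
    (hq : q ∈ W) (hr : r ∈ W) (h1 : p.2 < q.2) (h2 : q.2 < r.2) :
    (p.1 ≤ q.1 ∨ r.1 ≤ q.1) ∧ (q.1 ≤ p.1 ∨ q.1 ≤ r.1) := by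
  have hmono : ∀ {i j : ℤ}, i ≤ j → α ^ i ≤ α ^ j := fun hij => zpow_le_zpow_right₀ hα.le hij
  obtain ⟨l, hl, hl1, hy⟩ := exists_row_mem_segment (hmono h1.le) (hmono h2.le)
  have aux : ∀ x y z : ℝ, x ≤ z → y ≤ z → (1 - l) * x + l * y ≤ z := fun x y z hx hy => by
    nlinarith [mul_le_mul_of_nonneg_left hx (sub_nonneg.2 hl1), mul_le_mul_of_nonneg_left hy hl]
  have aux' : ∀ x y z : ℝ, z ≤ x → z ≤ y → z ≤ (1 - l) * x + l * y := fun x y z hx hy => by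
    nlinarith [mul_le_mul_of_nonneg_left hx (sub_nonneg.2 hl1), mul_le_mul_of_nonneg_left hy hl]
  constructor
  · by_contra! hlt
    -- Both `p` and `r` are at least one column to the right of `q`, so the next lattice point in
    -- the row of `q` lies between `q` and the segment `p r`.
    have hc : ExpCombination α p q r (q.1 + 1, q.2) :=
      expCombination_of_row hl hl1 rfl hy rfl (Or.inr ⟨hmono (by simp),
        aux' _ _ _ (hmono (by simp; omega)) (hmono (by simp; omega))⟩)
    have := h p hp q hq r hr _ hc
    simp only [Prod.ext_iff] at this
    omega
  · by_contra! hlt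
    have hc : ExpCombination α p q r (q.1 - 1, q.2) :=
      expCombination_of_row hl hl1 rfl hy rfl (Or.inl
        ⟨aux _ _ _ (hmono (by simp; omega)) (hmono (by simp; omega)), hmono (by simp)⟩)
    have := h p hp q hq r hr _ hc
    simp only [Prod.ext_iff] at this
    omega

theorem IsEmptyExponents.row_between (hα : 1 < α) (h : IsEmptyExponents α W) (hp : p ∈ W)
    (hq : q ∈ W) (hr : r ∈ W) (h1 : p.1 < q.1) (h2 : q.1 < r.1) :
    (p.2 ≤ q.2 ∨ r.2 ≤ q.2) ∧ (q.2 ≤ p.2 ∨ q.2 ≤ r.2) :=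
  h.swap.col_between hα (Finset.mem_image_of_mem _ hp) (Finset.mem_image_of_mem _ hq)
    (Finset.mem_image_of_mem _ hr) h1 h2

/-- Two points are weakly on a common descending line. -/
def Descending (p q : ℤ × ℤ) : Prop := p.1 ≤ q.1 ∧ q.2 ≤ p.2 ∨ q.1 ≤ p.1 ∧ p.2 ≤ q.2

/-- Two points are weakly on a common ascending line. -/
def Ascending (p q : ℤ × ℤ) : Prop := p.1 ≤ q.1 ∧ p.2 ≤ q.2 ∨ q.1 ≤ p.1 ∧ q.2 ≤ p.2

theorem Descending.symm (h : Descending p q) : Descending q p := Or.symm h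

theorem Ascending.symm (h : Ascending p q) : Ascending q p := Or.symm h

theorem IsEmptyExponents.triple_monotone (hα : 1 < α) (h : IsEmptyExponents α W) (hp : p ∈ W)
    (hq : q ∈ W) (hr : r ∈ W) :
    (Descending p q ∧ Descending q r ∧ Descending p r) ∨
      (Ascending p q ∧ Ascending q r ∧ Ascending p r) := by
  have sorted : ∀ {p q r : ℤ × ℤ}, p ∈ W → q ∈ W → r ∈ W → p.1 ≤ q.1 → q.1 ≤ r.1 →
      (Descending p q ∧ Descending q r ∧ Descending p r) ∨
      (Ascending p q ∧ Ascending q r ∧ Ascending p r) := by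
    intro p q r hp hq hr h1 h2
    have a1 := fun h1 h2 => h.col_between hα hp hr hq h1 h2
    have a2 := fun h1 h2 => h.col_between hα hq hp hr h1 h2
    have a3 := fun h1 h2 => h.col_between hα hq hr hp h1 h2
    have a4 := fun h1 h2 => h.col_between hα hr hp hq h1 h2
    have b1 := fun h1 h2 => h.row_between hα hp hq hr h1 h2
    clear hp hq hr h
    simp only [Descending, Ascending] at *
    rcases lt_trichotomy p.2 q.2 with h4 | h4 | h4 <;>
      rcases lt_trichotomy q.2 r.2 with h5 | h5 | h5 <;> omega
  rcases le_total p.1 q.1 with h1 | h1 <;> rcases le_total q.1 r.1 with h2 | h2 <;>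
    rcases le_total p.1 r.1 with h3 | h3
  · exact sorted hp hq hr h1 h2
  · exact sorted hp hq hr h1 h2
  · exact (sorted hp hr hq h3 h2).imp (fun ⟨x, y, z⟩ => ⟨z, y.symm, x⟩)
      fun ⟨x, y, z⟩ => ⟨z, y.symm, x⟩
  · exact (sorted hr hp hq h3 h1).imp (fun ⟨x, y, z⟩ => ⟨y, z.symm, x.symm⟩)
      fun ⟨x, y, z⟩ => ⟨y, z.symm, x.symm⟩
  · exact (sorted hq hp hr h1 h3).imp (fun ⟨x, y, z⟩ => ⟨x.symm, z, y⟩)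
      fun ⟨x, y, z⟩ => ⟨x.symm, z, y⟩
  · exact (sorted hq hr hp h2 h3).imp (fun ⟨x, y, z⟩ => ⟨z.symm, x, y.symm⟩)
      fun ⟨x, y, z⟩ => ⟨z.symm, x, y.symm⟩
  · exact (sorted hr hq hp h2 h1).imp (fun ⟨x, y, z⟩ => ⟨y.symm, x.symm, z.symm⟩)
      fun ⟨x, y, z⟩ => ⟨y.symm, x.symm, z.symm⟩
  · exact (sorted hr hq hp h2 h1).imp (fun ⟨x, y, z⟩ => ⟨y.symm, x.symm, z.symm⟩)
      fun ⟨x, y, z⟩ => ⟨y.symm, x.symm, z.symm⟩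

theorem IsEmptyExponents.monotone (hα : 1 < α) (h : IsEmptyExponents α W) (hcard : 4 < W.card) :
    (∀ p ∈ W, ∀ q ∈ W, Descending p q) ∨ (∀ p ∈ W, ∀ q ∈ W, Ascending p q) := by
  by_contra! hno
  obtain ⟨⟨r, hr, s, hs, hrs⟩, ⟨p, hp, q, hq, hpq⟩⟩ := hno
  wlog hlt : p.1 < q.1 generalizing p q
  · refine this q hq p hp (fun hA => hpq ?_) ?_ <;> simp only [Ascending] at * <;> omega
  wlog hlt' : r.1 < s.1 generalizing r s
  · refine this s hs r hr (fun hA => hrs ?_) ?_ <;> simp only [Descending] at * <;> omega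
  have key : W ⊆ {p, q, r, s} := by
    intro t ht
    have a1 := h.triple_monotone hα hp hq hr
    have a2 := h.triple_monotone hα hp hq hs
    have a3 := h.triple_monotone hα hp hq ht
    have b1 := h.triple_monotone hα hr hs hp
    have b2 := h.triple_monotone hα hr hs hq
    have b3 := h.triple_monotone hα hr hs ht
    have c1 := fun h1 h2 => h.row_adjacent hα hr hq h1 h2
    have c2 := fun h1 h2 => h.col_adjacent hα hr hp h1 h2
    clear h hp hq hr hs ht
    simp only [hpq, hrs, false_and, or_false, false_or] at a1 a2 a3 b1 b2 b3
    obtain ⟨p1, p2⟩ := p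
    obtain ⟨q1, q2⟩ := q
    obtain ⟨r1, r2⟩ := r
    obtain ⟨s1, s2⟩ := s
    obtain ⟨t1, t2⟩ := t
    simp only [Descending, Ascending, Finset.mem_insert, Finset.mem_singleton,
      Prod.mk.injEq] at *
    -- The descending pair `p, q` and the ascending pair `r, s` are the two diagonals of one
    -- rectangle. Adjacency makes its sides one exponent long, and `t`, monotone with both
    -- diagonals, can only be a corner.
    obtain ⟨hr1, hr2⟩ : r1 = p1 ∧ r2 = q2 := by omega
    obtain ⟨hs1, hs2⟩ : s1 = q1 ∧ s2 = p2 := by omega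
    subst hr1 hr2 hs1 hs2
    omega
  have := (Finset.card_le_card key).trans Finset.card_le_four
  omega

theorem Finset.card_le_four_of_forall_sub_le_one
    (h : ∀ p ∈ W, ∀ q ∈ W, q.1 ≤ p.1 + 1 ∧ q.2 ≤ p.2 + 1) : W.card ≤ 4 := by
  rcases W.eq_empty_or_nonempty with rfl | hne
  · simp
  obtain ⟨p, hp, hpmin⟩ := W.exists_min_image Prod.fst hne
  obtain ⟨q, hq, hqmin⟩ := W.exists_min_image Prod.snd hne
  have hsub : W ⊆ ({p.1, p.1 + 1} : Finset ℤ) ×ˢ ({q.2, q.2 + 1} : Finset ℤ) := by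
    intro t ht
    have h1 := h p hp t ht
    have h2 := h q hq t ht
    have h3 := hpmin t ht
    have h4 := hqmin t ht
    simp only [Finset.mem_product, Finset.mem_insert, Finset.mem_singleton]
    omega
  refine (Finset.card_le_card hsub).trans ?_
  rw [Finset.card_product]
  exact Nat.mul_le_mul Finset.card_le_two Finset.card_le_two

/-- Up to a projective symmetry of the exponential lattice, an empty set with at least five points
is descending. -/
theorem IsEmptyExponents.exists_descending (hα : 1 < α) (h : IsEmptyExponents α W)
    (hcard : 4 < W.card) :
    ∃ W' : Finset (ℤ × ℤ), IsEmptyExponents α W' ∧ W'.card = W.card ∧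
      ∀ p ∈ W', ∀ q ∈ W', Descending p q := by
  have hα0 : 0 < α := by linarith
  have hcard1 : (W.image projExp).card = W.card :=
    Finset.card_image_of_injective _ projExp_injective
  have hcard2 : ((W.image Prod.swap).image projExp).card = W.card := by
    rw [Finset.card_image_of_injective _ projExp_injective,
      Finset.card_image_of_injective _ Prod.swap_injective]
  by_contra! hno
  have key : ∀ W' : Finset (ℤ × ℤ), IsEmptyExponents α W' → W'.card = W.card →
      ∀ p ∈ W', ∀ q ∈ W', Ascending p q := fun W' h1 h2 =>
    (h1.monotone hα (h2 ▸ hcard)).resolve_left fun hd => by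
      obtain ⟨p, hp, q, hq, hpq⟩ := hno W' h1 h2
      exact hpq (hd p hp q hq)
  have k0 := key W h rfl
  have k1 := key _ (h.image_projExp hα0) hcard1
  have k2 := key _ (h.swap.image_projExp hα0) hcard2
  simp only [Finset.forall_mem_image] at k1 k2
  -- If all three images are ascending, any two points share a row, a column or a diagonal, so
  -- adjacency bounds both exponent differences by one.
  have := Finset.card_le_four_of_forall_sub_le_one (W := W) fun p hp q hq => by
    have a0 := k0 p hp q hq
    have a1 := k1 hp hq
    have a2 := k2 hp hq
    have c1 := fun h1 h2 => h.row_adjacent hα hp hq h1 h2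
    have c2 := fun h1 h2 => h.col_adjacent hα hp hq h1 h2
    have c3 := fun h1 h2 => h.diag_adjacent hα hp hq h1 h2
    simp only [Ascending, projExp, Prod.fst_swap, Prod.snd_swap] at a0 a1 a2
    omega
  omega

end ExponentSets

/-! ### Counting the points on each side of the chord -/

section DescendingBound

variable {α : ℝ} {W : Finset (ℤ × ℤ)} {p q r w : ℤ × ℤ}

/-- The data of a descending empty set: `p` is its upper left point, `r` its lower right point, and
`A * x + B * y = C` is the line joining them. -/
structure DescendingChord (α : ℝ) (W : Finset (ℤ × ℤ)) (p r : ℤ × ℤ) (A B C : ℝ) : Prop where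
  empty : IsEmptyExponents α W
  one_lt : 1 < α
  left_mem : p ∈ W
  right_mem : r ∈ W
  descending : ∀ q ∈ W, ∀ q' ∈ W, Descending q q'
  left_le : ∀ q ∈ W, p.1 ≤ q.1 ∧ q.2 ≤ p.2
  le_right : ∀ q ∈ W, q.1 ≤ r.1 ∧ r.2 ≤ q.2
  posA : 0 < A
  posB : 0 < B
  left_eq : A * α ^ p.1 + B * α ^ p.2 = C
  right_eq : A * α ^ r.1 + B * α ^ r.2 = C

variable {A B C : ℝ}

theorem DescendingChord.swap (h : DescendingChord α W p r A B C) :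
    DescendingChord α (W.image Prod.swap) r.swap p.swap B A C where
  empty := h.empty.swap
  one_lt := h.one_lt
  left_mem := Finset.mem_image_of_mem _ h.right_mem
  right_mem := Finset.mem_image_of_mem _ h.left_mem
  descending := by
    simp only [Finset.forall_mem_image]
    intro q hq q' hq'
    have := h.descending q hq q' hq'
    simp only [Descending, Prod.fst_swap, Prod.snd_swap] at *
    omega
  left_le := by
    simp only [Finset.forall_mem_image]
    exact fun q hq => (h.le_right q hq).symm
  le_right := by
    simp only [Finset.forall_mem_image]
    exact fun q hq => (h.left_le q hq).symm
  posA := h.posB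
  posB := h.posA
  left_eq := by rw [add_comm]; exact h.right_eq
  right_eq := by rw [add_comm]; exact h.left_eq

theorem DescendingChord.pow_le (h : DescendingChord α W p r A B C) {i j : ℤ} (hij : i ≤ j) :
    α ^ i ≤ α ^ j := zpow_le_zpow_right₀ h.one_lt.le hij

theorem DescendingChord.right_lt (h : DescendingChord α W p r A B C) : A * α ^ r.1 < C := by
  have := mul_pos h.posB (zpow_pos (by linarith [h.one_lt] : 0 < α) r.2)
  linarith [h.right_eq]

/-- The source of all numerical estimates: already `A * α ^ r.1` is below `C`, and each column to
the left gains a factor `α`. -/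
theorem DescendingChord.mul_pow_lt (h : DescendingChord α W p r A B C) (n : ℕ) {i : ℤ}
    (hi : i + n ≤ r.1) : α ^ n * (A * α ^ i) < C := by
  have hα : α ≠ 0 := by linarith [h.one_lt]
  calc α ^ n * (A * α ^ i) = A * α ^ (i + n) := by rw [zpow_add₀ hα, zpow_natCast]; ring
    _ ≤ A * α ^ r.1 := mul_le_mul_of_nonneg_left (h.pow_le hi) h.posA.le
    _ < C := h.right_lt

theorem DescendingChord.pos (h : DescendingChord α W p r A B C) : 0 < C := by
  have := mul_pos h.posA (zpow_pos (by linarith [h.one_lt] : 0 < α) r.1)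
  linarith [h.right_lt]

theorem DescendingChord.exists_chord_row (h : DescendingChord α W p r A B C) (h1 : r.2 ≤ q.2)
    (h2 : q.2 ≤ p.2) : ∃ l : ℝ, 0 ≤ l ∧ l ≤ 1 ∧ (1 - l) * α ^ r.2 + l * α ^ p.2 = α ^ q.2 ∧
      A * ((1 - l) * α ^ r.1 + l * α ^ p.1) + B * α ^ q.2 = C := by
  obtain ⟨l, hl, hl1, hy⟩ := exists_row_mem_segment (h.pow_le h1) (h.pow_le h2)
  refine ⟨l, hl, hl1, hy, ?_⟩
  rw [← hy]
  linear_combination (1 - l) * h.right_eq + l * h.left_eq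

/-- Such a `w` lies in the row of `q` between `q` and the chord, hence in the triangle `p q r`. -/
theorem DescendingChord.eq_or_eq_of_row (h : DescendingChord α W p r A B C) (hq : q ∈ W)
    (hw : w.2 = q.2) (hqw : q.1 ≤ w.1) (hC : A * α ^ w.1 + B * α ^ w.2 ≤ C) :
    w = r ∨ w = q ∨ w = p := by
  obtain ⟨l, hl, hl1, hy, hx⟩ := h.exists_chord_row (h.le_right q hq).2 (h.left_le q hq).2
  refine h.empty r h.right_mem q hq p h.left_mem w
    (expCombination_of_row hl hl1 rfl hy hw (Or.inr ⟨h.pow_le hqw, ?_⟩))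
  rw [hw] at hC
  exact le_of_mul_le_mul_left (by linarith) h.posA

theorem DescendingChord.ne_chord (h : DescendingChord α W p r A B C) (hq : q ∈ W)
    (hqp : q ≠ p) (hqr : q ≠ r) : A * α ^ q.1 + B * α ^ q.2 ≠ C := by
  intro hC
  obtain ⟨l, hl, hl1, hy, hx⟩ := h.exists_chord_row (h.le_right q hq).2 (h.left_le q hq).2
  have hx' : (1 - l) * α ^ r.1 + l * α ^ p.1 = α ^ q.1 :=
    mul_left_cancel₀ h.posA.ne' (by linarith)
  have := h.empty r h.right_mem p h.left_mem p h.left_mem q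
    ⟨1 - l, l, 0, by linarith, hl, le_rfl, by ring, by linarith, by linarith⟩
  tauto

theorem DescendingChord.fst_lt_of_below (h : DescendingChord α W p r A B C) (hq : q ∈ W)
    (hC : A * α ^ q.1 + B * α ^ q.2 < C) : q.1 < r.1 := by
  by_contra! hle
  have h1 := mul_le_mul_of_nonneg_left (h.pow_le hle) h.posA.le
  have h2 := mul_le_mul_of_nonneg_left (h.pow_le (h.le_right q hq).2) h.posB.le
  linarith [h.right_eq]

theorem DescendingChord.snd_lt_of_below (h : DescendingChord α W p r A B C) (hq : q ∈ W)
    (hC : A * α ^ q.1 + B * α ^ q.2 < C) : q.2 < p.2 :=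
  h.swap.fst_lt_of_below (Finset.mem_image_of_mem _ hq) (by simpa [add_comm] using hC)

/-- If the corner `(b'.1, b.2)` were not above the chord, it would lie in the triangle over `b`
along its row and in the one over `b'` along its column. Since it is neither `p` nor `r`, it would
equal both `b` and `b'`. -/
theorem DescendingChord.corner_of_below (h : DescendingChord α W p r A B C) {b b' : ℤ × ℤ}
    (hb : b ∈ W) (hb' : b' ∈ W) (hC : A * α ^ b.1 + B * α ^ b.2 < C)
    (hC' : A * α ^ b'.1 + B * α ^ b'.2 < C) (h1 : b.1 ≤ b'.1) (h3 : b'.2 ≤ b.2)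
    (hne : b ≠ b') : b.1 < b'.1 ∧ C < A * α ^ b'.1 + B * α ^ b.2 := by
  have l1 := h.fst_lt_of_below hb' hC'
  have l2 := h.snd_lt_of_below hb hC
  have key : C < A * α ^ b'.1 + B * α ^ b.2 := by
    by_contra! hle
    have e1 := h.eq_or_eq_of_row (w := (b'.1, b.2)) hb rfl h1 hle
    have e2 := h.swap.eq_or_eq_of_row (q := b'.swap) (w := (b.2, b'.1))
      (Finset.mem_image_of_mem _ hb') rfl h3 (by simpa [add_comm] using hle)
    simp only [Prod.ext_iff, ne_eq, Prod.fst_swap, Prod.snd_swap] at e1 e2 hne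
    omega
  refine ⟨lt_of_le_of_ne h1 fun he => ?_, key⟩
  rw [← he] at key
  linarith

theorem DescendingChord.mul_pow_lt_snd (h : DescendingChord α W p r A B C) (n : ℕ) {i : ℤ}
    (hi : i + n ≤ p.2) : α ^ n * (B * α ^ i) < C :=
  h.swap.mul_pow_lt n hi

theorem DescendingChord.card_below_le_one (h : DescendingChord α W p r A B C) (hα : 2 ≤ α) :
    (W.filter fun q => A * α ^ q.1 + B * α ^ q.2 < C).card ≤ 1 := by
  rw [Finset.card_le_one]
  simp only [Finset.mem_filter]
  have key : ∀ b ∈ W, ∀ b' ∈ W, A * α ^ b.1 + B * α ^ b.2 < C →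
      A * α ^ b'.1 + B * α ^ b'.2 < C → b.1 ≤ b'.1 → b'.2 ≤ b.2 → b = b' := by
    intro b hb b' hb' hC hC' h1 h2
    by_contra hne
    have hc := (h.corner_of_below hb hb' hC hC' h1 h2 hne).2
    have l1 := h.mul_pow_lt 1 (i := b'.1) (by have := h.fst_lt_of_below hb' hC'; omega)
    have l2 := h.mul_pow_lt_snd 1 (i := b.2) (by have := h.snd_lt_of_below hb hC; omega)
    nlinarith [h.pos]
  rintro b ⟨hb, hC⟩ b' ⟨hb', hC'⟩
  rcases h.descending b hb b' hb' with ⟨h1, h2⟩ | ⟨h1, h2⟩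
  · exact key b hb b' hb' hC hC' h1 h2
  · exact (key b' hb' b hb hC' hC h1 h2).symm

theorem DescendingChord.not_three_below (h : DescendingChord α W p r A B C) (hα : α + 1 ≤ α ^ 2)
    {b b' b'' : ℤ × ℤ} (hb : b ∈ W) (hb' : b' ∈ W) (hb'' : b'' ∈ W)
    (hC : A * α ^ b.1 + B * α ^ b.2 < C) (hC' : A * α ^ b'.1 + B * α ^ b'.2 < C)
    (hC'' : A * α ^ b''.1 + B * α ^ b''.2 < C) (h1 : b.1 < b'.1) (h2 : b'.1 < b''.1) : False := by
  have h3 : b'.2 ≤ b.2 := by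
    have := h.descending b hb b' hb'
    simp only [Descending] at this
    omega
  have hc := (h.corner_of_below hb hb' hC hC' h1.le h3 (by rintro rfl; omega)).2
  -- The third point pushes `b'` two columns left of `r`, so the corner has value below `C / α ^ 2 +
  -- C / α ≤ C`.
  have l1 := h.mul_pow_lt 2 (i := b'.1)
    (by have := h.fst_lt_of_below hb'' hC''; push_cast; omega)
  have l2 := h.mul_pow_lt_snd 1 (i := b.2) (by have := h.snd_lt_of_below hb hC; omega)
  nlinarith [h.pos, h.one_lt]

theorem DescendingChord.card_below_le_two (h : DescendingChord α W p r A B C)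
    (hα : α + 1 ≤ α ^ 2) : (W.filter fun q => A * α ^ q.1 + B * α ^ q.2 < C).card ≤ 2 := by
  by_contra! hcard
  obtain ⟨a, b, c, ha, hb, hc, hab, hac, hbc⟩ := Finset.two_lt_card_iff.1 hcard
  simp only [Finset.mem_filter] at ha hb hc
  have key : ∀ b b', b ∈ W ∧ A * α ^ b.1 + B * α ^ b.2 < C →
      b' ∈ W ∧ A * α ^ b'.1 + B * α ^ b'.2 < C → b ≠ b' → b.1 < b'.1 ∨ b'.1 < b.1 := by
    rintro b b' ⟨hb, hC⟩ ⟨hb', hC'⟩ hne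
    rcases h.descending b hb b' hb' with ⟨h1, h2⟩ | ⟨h1, h2⟩
    · exact Or.inl (h.corner_of_below hb hb' hC hC' h1 h2 hne).1
    · exact Or.inr (h.corner_of_below hb' hb hC' hC h1 h2 hne.symm).1
  have key3 : ∀ {b b' b''}, b ∈ W ∧ A * α ^ b.1 + B * α ^ b.2 < C →
      b' ∈ W ∧ A * α ^ b'.1 + B * α ^ b'.2 < C → b'' ∈ W ∧ A * α ^ b''.1 + B * α ^ b''.2 < C →
      b.1 < b'.1 → b'.1 < b''.1 → False := fun h1 h2 h3 =>
    h.not_three_below hα h1.1 h2.1 h3.1 h1.2 h2.2 h3.2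
  rcases key a b ha hb hab with h1 | h1 <;> rcases key b c hb hc hbc with h2 | h2 <;>
    rcases key a c ha hc hac with h3 | h3
  · exact key3 ha hb hc h1 h2
  · exact key3 ha hb hc h1 h2
  · exact key3 ha hc hb h3 h2
  · exact key3 hc ha hb h3 h1
  · exact key3 hb ha hc h1 h3
  · exact key3 hb hc ha h2 h3
  · exact key3 hc hb ha h2 h1
  · exact key3 hc hb ha h2 h1

theorem DescendingChord.card_above_eq_zero (h : DescendingChord α W p r A B C) (hα : 2 ≤ α) :
    (W.filter fun q => C < A * α ^ q.1 + B * α ^ q.2 ∧ q.1 < r.1 ∧ q.2 < p.2).card ≤ 0 := by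
  rw [Nat.le_zero, Finset.card_eq_zero, Finset.filter_eq_empty_iff]
  rintro q hq ⟨hC, h1, h2⟩
  have l1 := h.mul_pow_lt 1 (i := q.1) (by omega)
  have l2 := h.mul_pow_lt_snd 1 (i := q.2) (by omega)
  nlinarith [h.pos]

theorem DescendingChord.card_above_le_one (h : DescendingChord α W p r A B C)
    (hα : α + 1 ≤ α ^ 2) :
    (W.filter fun q => C < A * α ^ q.1 + B * α ^ q.2 ∧ q.1 < r.1 ∧ q.2 < p.2).card ≤ 1 := by
  rw [Finset.card_le_one]
  simp only [Finset.mem_filter]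
  -- Being two columns left of `r` or two rows below `p` is too far to be above the chord, which
  -- leaves only the position `(r.1 - 1, p.2 - 1)`.
  have left : ∀ q ∈ W, C < A * α ^ q.1 + B * α ^ q.2 → q.1 + 2 ≤ r.1 → q.2 < p.2 → False := by
    intro q hq hC h1 h2
    have l1 := h.mul_pow_lt 2 (i := q.1) (by push_cast; omega)
    have l2 := h.mul_pow_lt_snd 1 (i := q.2) (by omega)
    nlinarith [h.pos, h.one_lt]
  have right : ∀ q ∈ W, C < A * α ^ q.1 + B * α ^ q.2 → q.1 < r.1 → q.2 + 2 ≤ p.2 → False := by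
    intro q hq hC h1 h2
    have l1 := h.mul_pow_lt 1 (i := q.1) (by omega)
    have l2 := h.mul_pow_lt_snd 2 (i := q.2) (by push_cast; omega)
    nlinarith [h.pos, h.one_lt]
  rintro a ⟨ha, hC, h1, h2⟩ a' ⟨ha', hC', h1', h2'⟩
  have l1 := fun x => left a ha hC x h2
  have l2 := fun x => left a' ha' hC' x h2'
  have l3 := right a ha hC h1
  have l4 := right a' ha' hC' h1'
  have hd := h.descending a ha a' ha'
  simp only [Descending, imp_false] at *
  exact Prod.ext (by omega) (by omega)

theorem DescendingChord.card_row_le_one (h : DescendingChord α W p r A B C) :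
    (W.filter fun q => q.2 = p.2 ∧ q ≠ p).card ≤ 1 := by
  rw [Finset.card_le_one]
  simp only [Finset.mem_filter, ne_eq, Prod.ext_iff]
  have key : ∀ q ∈ W, q.2 = p.2 → q.1 ≠ p.1 → q.1 = p.1 + 1 := fun q hq h1 h2 =>
    h.empty.row_adjacent h.one_lt h.left_mem hq h1.symm
      (lt_of_le_of_ne (h.left_le q hq).1 h2.symm)
  rintro a ⟨ha, h1, h2⟩ a' ⟨ha', h1', h2'⟩
  have := key a ha h1 (fun e => h2 ⟨e, h1⟩)
  have := key a' ha' h1' (fun e => h2' ⟨e, h1'⟩)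
  omega

theorem DescendingChord.card_col_le_one (h : DescendingChord α W p r A B C) :
    (W.filter fun q => q.1 = r.1 ∧ q ≠ r).card ≤ 1 := by
  have := h.swap.card_row_le_one
  rw [Finset.filter_image, Finset.card_image_of_injective _ Prod.swap_injective] at this
  simpa using this

theorem DescendingChord.card_le (h : DescendingChord α W p r A B C) {m n : ℕ}
    (hm : (W.filter fun q => A * α ^ q.1 + B * α ^ q.2 < C).card ≤ m)
    (hn : (W.filter fun q => C < A * α ^ q.1 + B * α ^ q.2 ∧ q.1 < r.1 ∧ q.2 < p.2).card ≤ n) :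
    W.card ≤ 4 + m + n := by
  have hsub : W ⊆ ({p, r} ∪ W.filter fun q => A * α ^ q.1 + B * α ^ q.2 < C) ∪
      ((W.filter fun q => C < A * α ^ q.1 + B * α ^ q.2 ∧ q.1 < r.1 ∧ q.2 < p.2) ∪
      ((W.filter fun q => q.2 = p.2 ∧ q ≠ p) ∪ (W.filter fun q => q.1 = r.1 ∧ q ≠ r))) := by
    intro q hq
    have h1 := h.left_le q hq
    have h2 := h.le_right q hq
    simp only [Finset.mem_union, Finset.mem_insert, Finset.mem_singleton, Finset.mem_filter, hq,
      true_and]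
    by_cases hqp : q = p
    · exact Or.inl (Or.inl (Or.inl hqp))
    by_cases hqr : q = r
    · exact Or.inl (Or.inl (Or.inr hqr))
    rcases lt_or_gt_of_ne (h.ne_chord hq hqp hqr) with hlt | hgt
    · exact Or.inl (Or.inr hlt)
    · rcases h1.2.lt_or_eq with e1 | e1
      · rcases h2.1.lt_or_eq with e2 | e2
        · exact Or.inr (Or.inl ⟨hgt, e2, e1⟩)
        · exact Or.inr (Or.inr (Or.inr ⟨e2, hqr⟩))
      · exact Or.inr (Or.inr (Or.inl ⟨e1, hqp⟩))
  have c1 := h.card_row_le_one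
  have c2 := h.card_col_le_one
  have c3 : ({p, r} : Finset (ℤ × ℤ)).card ≤ 2 := Finset.card_le_two
  refine (Finset.card_le_card hsub).trans ((Finset.card_union_le _ _).trans ?_)
  refine (add_le_add (Finset.card_union_le _ _) ((Finset.card_union_le _ _).trans
    (add_le_add le_rfl (Finset.card_union_le _ _)))).trans ?_
  omega

theorem IsEmptyExponents.exists_descendingChord (h : IsEmptyExponents α W) (hα : 1 < α)
    (hcard : 2 < W.card) (hd : ∀ q ∈ W, ∀ q' ∈ W, Descending q q') :
    ∃ p r A B C, DescendingChord α W p r A B C := by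
  have hne : W.Nonempty := Finset.card_pos.1 (by omega)
  -- In a descending set, an extreme value of `q.1 - q.2` is extreme in both coordinates at once.
  obtain ⟨p, hp, hpmin⟩ := W.exists_min_image (fun q => q.1 - q.2) hne
  obtain ⟨r, hr, hrmax⟩ := W.exists_max_image (fun q => q.1 - q.2) hne
  have hpl : ∀ q ∈ W, p.1 ≤ q.1 ∧ q.2 ≤ p.2 := fun q hq => by
    have h1 := hpmin q hq
    have h2 := hd p hp q hq
    simp only [Descending] at h1 h2
    omega
  have hrl : ∀ q ∈ W, q.1 ≤ r.1 ∧ r.2 ≤ q.2 := fun q hq => by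
    have h1 := hrmax q hq
    have h2 := hd r hr q hq
    simp only [Descending] at h1 h2
    omega
  have hline : ¬ (p.1 = r.1 ∨ p.2 = r.2) := by
    intro hor
    have hsub : W ⊆ {p, r} := by
      intro q hq
      have h1 := hpl q hq
      have h2 := hrl q hq
      have a1 := fun h1 h2 => h.row_adjacent hα hp hr h1 h2
      have a2 := fun h1 h2 => h.col_adjacent hα hr hp h1 h2
      simp only [Finset.mem_insert, Finset.mem_singleton, Prod.ext_iff]
      omega
    have := (Finset.card_le_card hsub).trans Finset.card_le_two
    omega
  have h1 := hpl r hr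
  refine ⟨p, r, α ^ p.2 - α ^ r.2, α ^ r.1 - α ^ p.1, α ^ r.1 * α ^ p.2 - α ^ p.1 * α ^ r.2,
    h, hα, hp, hr, hd, hpl, hrl, ?_, ?_, by ring, by ring⟩
  · exact sub_pos.2 (zpow_lt_zpow_right₀ hα (by omega))
  · exact sub_pos.2 (zpow_lt_zpow_right₀ hα (by omega))

theorem IsEmptyExponents.card_le_five (h : IsEmptyExponents α W) (hα : 2 ≤ α) : W.card ≤ 5 := by
  by_contra! hcard
  obtain ⟨W', h', hW, hd⟩ := h.exists_descending (by linarith) (by omega)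
  obtain ⟨p, r, A, B, C, hc⟩ := h'.exists_descendingChord (by linarith) (by omega) hd
  have := hc.card_le (hc.card_below_le_one hα) (hc.card_above_eq_zero hα)
  omega

theorem IsEmptyExponents.card_le_seven (h : IsEmptyExponents α W) (hα1 : 1 < α)
    (hα : α + 1 ≤ α ^ 2) : W.card ≤ 7 := by
  by_contra! hcard
  obtain ⟨W', h', hW, hd⟩ := h.exists_descending hα1 (by omega)
  obtain ⟨p, r, A, B, C, hc⟩ := h'.exists_descendingChord hα1 (by omega) hd
  have := hc.card_le (hc.card_below_le_two hα) (hc.card_above_le_one hα)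
  omega

end DescendingBound

/-! ### From the exponential lattice to integer exponents -/

section ExpLattice

variable {α : ℝ}

theorem expLattice_inter_finite (hα : 1 < α) (B : Set (ℝ × ℝ)) (hB : Bornology.IsBounded B) :
    (expLattice α ∩ B).Finite := by
  obtain ⟨R, hR⟩ := hB.exists_norm_le
  obtain ⟨N, hN⟩ := pow_unbounded_of_one_lt R hα
  refine (((Set.finite_Iio N).image fun n : ℕ => α ^ n).prod
    ((Set.finite_Iio N).image fun n : ℕ => α ^ n)).subset ?_
  rintro ⟨x, y⟩ ⟨⟨⟨i, hi⟩, ⟨j, hj⟩⟩, hxB⟩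
  have hn := hR _ hxB
  simp only at hi hj
  have key : ∀ n : ℕ, |α ^ n| ≤ R → n < N := fun n hle =>
    (pow_lt_pow_iff_right₀ hα).1 ((le_abs_self _).trans_lt (hle.trans_lt hN))
  exact ⟨⟨i, key i (by rw [hi]; exact (norm_fst_le _).trans hn), hi⟩,
    ⟨j, key j (by rw [hj]; exact (norm_snd_le _).trans hn), hj⟩⟩

theorem one_le_of_mem_expLattice (hα : 1 < α) {v : ℝ × ℝ} (hv : v ∈ expLattice α) :
    1 ≤ v.1 ∧ 1 ≤ v.2 := by
  obtain ⟨⟨i, hi⟩, ⟨j, hj⟩⟩ := hv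
  exact ⟨hi ▸ one_le_pow₀ hα.le, hj ▸ one_le_pow₀ hα.le⟩

theorem le_of_mem_convexHull_prod {V : Set (ℝ × ℝ)} {a b c : ℝ}
    (h : ∀ u ∈ V, a * u.1 + b * u.2 ≤ c) {x : ℝ × ℝ} (hx : x ∈ convexHull ℝ V) :
    a * x.1 + b * x.2 ≤ c := by
  have hconv : Convex ℝ {x : ℝ × ℝ | a * x.1 + b * x.2 ≤ c} :=
    convex_halfSpace_le (f := fun x : ℝ × ℝ => a * x.1 + b * x.2)
      ⟨fun x y => by simp; ring, fun t x => by simp; ring⟩ c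
  exact convexHull_min h hconv hx

theorem notMem_convexHull_of_exposed {V : Set (ℝ × ℝ)} {v : ℝ × ℝ} (a b : ℝ)
    (h : ∀ u ∈ V, u ≠ v → a * u.1 + b * u.2 < a * v.1 + b * v.2) :
    v ∉ convexHull ℝ (V \ {v}) := by
  intro hv
  have hconv : Convex ℝ {x : ℝ × ℝ | a * x.1 + b * x.2 < a * v.1 + b * v.2} :=
    convex_halfSpace_lt (f := fun x : ℝ × ℝ => a * x.1 + b * x.2)
      ⟨fun x y => by simp; ring, fun t x => by simp; ring⟩ _
  have hlt : a * v.1 + b * v.2 < a * v.1 + b * v.2 :=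
    convexHull_min (fun u hu => h u hu.1 hu.2) hconv hv
  exact lt_irrefl _ hlt

theorem IsEmptyVertexSet.exists_isEmptyExponents (hα : 1 < α) {V : Set (ℝ × ℝ)}
    (hV : IsEmptyVertexSet (expLattice α) V) :
    ∃ W : Finset (ℤ × ℤ), IsEmptyExponents α W ∧ V.encard = W.card := by
  classical
  have hα0 : 0 < α := by linarith
  let e : ℤ × ℤ → ℝ × ℝ := fun w => (α ^ w.1, α ^ w.2)
  have he : Function.Injective e := by
    intro p q hpq
    simp only [e, Prod.mk.injEq] at hpq
    exact Prod.ext (zpow_right_injective₀ hα0 hα.ne' hpq.1)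
      (zpow_right_injective₀ hα0 hα.ne' hpq.2)
  have hfin : (e ⁻¹' V).Finite := hV.finite.preimage he.injOn
  have hmem : ∀ w, w ∈ hfin.toFinset ↔ e w ∈ V := fun w => by simp
  have hrange : V ⊆ Set.range e := by
    intro v hv
    obtain ⟨⟨i, hi⟩, ⟨j, hj⟩⟩ := hV.subset hv
    exact ⟨(i, j), Prod.ext (by simpa [e] using hi) (by simpa [e] using hj)⟩
  refine ⟨hfin.toFinset, ?_, ?_⟩
  · intro p hp q hq r hr w hw
    rw [hmem] at hp hq hr
    have hcomb : e w ∈ convexHull ℝ {e p, e q, e r} := by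
      obtain ⟨a, b, c, ha, hb, hc, h1, h2, h3⟩ := hw
      have : e w = a • e p + b • e q + c • e r := by
        ext <;> simp [e, h2, h3]
      rw [this]
      have hsum := (convex_convexHull ℝ {e p, e q, e r}).sum_mem (t := Finset.univ)
        (w := ![a, b, c]) (z := ![e p, e q, e r]) (by simp [Fin.forall_fin_succ, ha, hb, hc])
        (by simpa [Fin.sum_univ_three] using h1)
        (fun i _ => subset_convexHull ℝ _ (by fin_cases i <;> simp))
      simpa [Fin.sum_univ_three] using hsum
    have hsub : {e p, e q, e r} ⊆ V := by
      rintro _ (rfl | rfl | rfl) <;> assumption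
    have hwV : e w ∈ convexHull ℝ V := convexHull_mono hsub hcomb
    -- The hull stays in the quadrant `x, y ≥ 1`, so the integer exponents of `w` are nonnegative
    -- and its point really belongs to the lattice.
    have h1 : 1 ≤ α ^ w.1 := by
      have := le_of_mem_convexHull_prod (a := -1) (b := 0) (c := -1)
        (fun u hu => by linarith [(one_le_of_mem_expLattice hα (hV.subset hu)).1]) hwV
      simp only [e] at this
      linarith
    have h2 : 1 ≤ α ^ w.2 := by
      have := le_of_mem_convexHull_prod (a := 0) (b := -1) (c := -1)
        (fun u hu => by linarith [(one_le_of_mem_expLattice hα (hV.subset hu)).2]) hwV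
      simp only [e] at this
      linarith
    rw [one_le_zpow_iff_right₀ hα] at h1 h2
    have hwS : e w ∈ expLattice α := by
      refine ⟨⟨w.1.toNat, ?_⟩, ⟨w.2.toNat, ?_⟩⟩
      · simp only [e, ← zpow_natCast, Int.toNat_of_nonneg h1]
      · simp only [e, ← zpow_natCast, Int.toNat_of_nonneg h2]
    have hwV' := hV.inter_subset ⟨hwV, hwS⟩
    by_contra! hne
    refine hV.notMem_convexHull _ hwV' (convexHull_mono ?_ hcomb)
    intro u hu
    refine ⟨hsub hu, ?_⟩
    rcases hu with rfl | rfl | rfl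
    · exact fun h => hne.1 (he h).symm
    · exact fun h => hne.2.1 (he h).symm
    · exact fun h => hne.2.2 (he h).symm
  · rw [← Set.encard_coe_eq_coe_finsetCard, Set.Finite.coe_toFinset,
      Set.encard_preimage_of_injective_subset_range he hrange]

/-! ### The extremal pentagon and heptagon -/

theorem encard_image_pow (hα : 1 < α) (W : Finset (ℕ × ℕ)) :
    ((fun w : ℕ × ℕ => (α ^ w.1, α ^ w.2)) '' (W : Set (ℕ × ℕ))).encard = W.card := by
  rw [Function.Injective.encard_image, Set.encard_coe_eq_coe_finsetCard]
  intro p q hpq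
  simp only [Prod.mk.injEq] at hpq
  exact Prod.ext (pow_right_injective₀ (by linarith) hα.ne' hpq.1)
    (pow_right_injective₀ (by linarith) hα.ne' hpq.2)

theorem isEmptyVertexSet_image_pow (W : Finset (ℕ × ℕ))
    (hempty : ∀ i j : ℕ, (α ^ i, α ^ j) ∈
      convexHull ℝ ((fun w : ℕ × ℕ => (α ^ w.1, α ^ w.2)) '' (W : Set (ℕ × ℕ))) → (i, j) ∈ W)
    (hexp : ∀ v ∈ W, ∃ a b : ℝ, ∀ u ∈ W, u ≠ v →
      a * α ^ u.1 + b * α ^ u.2 < a * α ^ v.1 + b * α ^ v.2) :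
    IsEmptyVertexSet (expLattice α)
      ((fun w : ℕ × ℕ => (α ^ w.1, α ^ w.2)) '' (W : Set (ℕ × ℕ))) where
  finite := W.finite_toSet.image _
  subset := by
    rintro _ ⟨w, -, rfl⟩
    exact ⟨⟨w.1, rfl⟩, ⟨w.2, rfl⟩⟩
  inter_subset := by
    rintro ⟨x, y⟩ ⟨hx, ⟨i, rfl⟩, ⟨j, rfl⟩⟩
    exact ⟨(i, j), hempty i j hx, rfl⟩
  notMem_convexHull := by
    rintro _ ⟨v, hv, rfl⟩
    obtain ⟨a, b, hab⟩ := hexp v hv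
    refine notMem_convexHull_of_exposed a b ?_
    rintro _ ⟨u, hu, rfl⟩ hne
    exact hab u hu (by rintro rfl; exact hne rfl)

theorem le_of_mem_convexHull_image_pow {W : Finset (ℕ × ℕ)} {i j : ℕ} (hx : (α ^ i, α ^ j) ∈
      convexHull ℝ ((fun w : ℕ × ℕ => (α ^ w.1, α ^ w.2)) '' (W : Set (ℕ × ℕ)))) (a b c : ℝ)
    (h : ∀ w ∈ W, a * α ^ w.1 + b * α ^ w.2 ≤ c) : a * α ^ i + b * α ^ j ≤ c := by
  refine le_of_mem_convexHull_prod ?_ hx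
  rintro _ ⟨w, hw, rfl⟩
  exact h w hw

theorem exists_isEmptyVertexSet_five (hα : 1 < α) :
    ∃ V : Set (ℝ × ℝ), IsEmptyVertexSet (expLattice α) V ∧ V.encard = (5 : ℕ) := by
  refine ⟨_, isEmptyVertexSet_image_pow {(0, 2), (1, 1), (1, 2), (2, 0), (2, 1)} ?_ ?_,
    encard_image_pow hα _⟩
  · intro i j hx
    have bound := le_of_mem_convexHull_image_pow hx
    simp only [Finset.mem_insert, Finset.mem_singleton, forall_eq_or_imp, forall_eq, pow_zero,
      pow_one] at bound
    have h1 := bound 1 0 (α ^ 2) ⟨by nlinarith, by nlinarith, by nlinarith, by nlinarith,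
      by nlinarith⟩
    have h2 := bound 0 1 (α ^ 2) ⟨by nlinarith, by nlinarith, by nlinarith, by nlinarith,
      by nlinarith⟩
    have h3 := bound 1 1 (α ^ 2 + α) ⟨by nlinarith, by nlinarith, by nlinarith, by nlinarith,
      by nlinarith⟩
    have h4 := bound (-1) (-1) (-2 * α) ⟨by nlinarith, by nlinarith, by nlinarith, by nlinarith,
      by nlinarith⟩
    have hi : i ≤ 2 := (pow_le_pow_iff_right₀ hα).1 (by linarith)
    have hj : j ≤ 2 := (pow_le_pow_iff_right₀ hα).1 (by linarith)
    clear bound hx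
    interval_cases i <;> interval_cases j <;>
      first | (simp; done) | (exfalso; (try simp only [pow_zero, pow_one] at h1 h2 h3 h4); nlinarith)
  · simp only [Finset.mem_insert, Finset.mem_singleton, forall_eq_or_imp, forall_eq]
    refine ⟨⟨-1, 0, ?_⟩, ⟨-1, -1, ?_⟩, ⟨1, 2, ?_⟩, ⟨0, -1, ?_⟩, ⟨2, 1, ?_⟩⟩ <;>
    · refine ⟨?_, ?_, ?_, ?_, ?_⟩ <;> intro hne <;>
        first | exact absurd rfl hne | (simp only [pow_zero, pow_one]; nlinarith)

set_option maxHeartbeats 2000000 in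
theorem exists_isEmptyVertexSet_seven (hα1 : 1 < α) (hα : α + 1 ≤ α ^ 2) (hα2 : α < 2) :
    ∃ V : Set (ℝ × ℝ), IsEmptyVertexSet (expLattice α) V ∧ V.encard = (7 : ℕ) := by
  -- With `Y = α ^ m`, the condition `Y * (2 - α) > 1` says that `(m + 1, m + 1)` protrudes beyond
  -- the line through `(1, m + 2)` and `(m + 2, 1)`.
  obtain ⟨m, hm⟩ := pow_unbounded_of_one_lt (1 / (2 - α)) hα1
  have hY2 : 1 < α ^ m * (2 - α) := by rwa [div_lt_iff₀ (by linarith)] at hm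
  have hm1 : 1 ≤ m := by
    by_contra! h0
    simp only [Nat.lt_one_iff.1 h0, pow_zero] at hY2
    linarith
  obtain ⟨Y, hY⟩ : ∃ Y, Y = α ^ m := ⟨_, rfl⟩
  have hYα : α ≤ Y := by
    have := pow_le_pow_right₀ hα1.le hm1
    rwa [pow_one, ← hY] at this
  have e1 : α ^ (m + 1) = α * Y := by rw [hY]; ring
  have e2 : α ^ (m + 2) = α ^ 2 * Y := by rw [hY]; ring
  rw [← hY] at hY2
  have g0 : α < α ^ 2 := by nlinarith
  have g1 : α ^ 2 ≤ α * Y := by nlinarith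
  have g2 : Y < α * Y := by nlinarith
  have g3 : 0 ≤ Y * (α ^ 2 - α - 1) := mul_nonneg (by linarith) (by linarith)
  have g4 : 0 < α * (Y * (2 - α) - 1) := mul_pos (by linarith) (by linarith)
  have g5 : 0 < α ^ 2 * (Y * (2 - α) - 1) := mul_pos (by positivity) (by linarith)
  have g6 : 0 ≤ Y * (α - 1) ^ 2 := mul_nonneg (by linarith) (by positivity)
  have g7 : 0 < α ^ 2 * Y := mul_pos (by positivity) (by linarith)
  have g8 : 0 ≤ (α ^ 2 * Y) * (Y * (α ^ 2 - α - 1)) := mul_nonneg g7.le g3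
  have g9 : 0 < (α ^ 2 * Y) * (α * Y - Y) := mul_pos g7 (by linarith)
  have g10 : 0 < (α ^ 2 * Y) * (α - 1) := mul_pos g7 (by linarith)
  have hcard : ({(0, m + 2), (1, m + 2), (m + 1, m + 1), (m + 2, 1), (m + 2, 0), (m + 1, m),
      (m, m + 1)} : Finset (ℕ × ℕ)).card = 7 := by
    repeat rw [Finset.card_insert_of_notMem (by
      simp only [Finset.mem_insert, Finset.mem_singleton, Prod.mk.injEq]; omega)]
    simp
  refine ⟨_, isEmptyVertexSet_image_pow {(0, m + 2), (1, m + 2), (m + 1, m + 1), (m + 2, 1),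
    (m + 2, 0), (m + 1, m), (m, m + 1)} ?_ ?_, (encard_image_pow hα1 _).trans (by rw [hcard])⟩
  · intro i j hx
    have bound := le_of_mem_convexHull_image_pow hx
    clear hx
    simp only [Finset.mem_insert, Finset.mem_singleton, forall_eq_or_imp, forall_eq, pow_zero,
      pow_one, e1, e2, ← hY, Prod.mk.injEq] at bound ⊢
    -- Five half-planes suffice: `h3` and `h4` cut the top row and the last column after exponent
    -- `1`, while `h5`, which rests on `α + 1 ≤ α ^ 2`, excludes exponents below `m` next to an
    -- exponent `m + 1`.
    have h1 := bound 1 0 (α ^ 2 * Y) (by refine ⟨?_, ?_, ?_, ?_, ?_, ?_, ?_⟩ <;> linarith)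
    have h2 := bound 0 1 (α ^ 2 * Y) (by refine ⟨?_, ?_, ?_, ?_, ?_, ?_, ?_⟩ <;> linarith)
    have h3 := bound (α - 1) 1 (α ^ 2 * Y + α * (α - 1))
      (by refine ⟨?_, ?_, ?_, ?_, ?_, ?_, ?_⟩ <;> linarith)
    have h4 := bound 1 (α - 1) (α ^ 2 * Y + α * (α - 1))
      (by refine ⟨?_, ?_, ?_, ?_, ?_, ?_, ?_⟩ <;> linarith)
    have h5 := bound (-1) (-1) (-(1 + α) * Y)
      (by refine ⟨?_, ?_, ?_, ?_, ?_, ?_, ?_⟩ <;> linarith)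
    clear bound
    have le_iff : ∀ {k l : ℕ}, α ^ k ≤ α ^ l ↔ k ≤ l := pow_le_pow_iff_right₀ hα1
    have hi : i ≤ m + 2 := le_iff.1 (by rw [e2]; linarith)
    have hj : j ≤ m + 2 := le_iff.1 (by rw [e2]; linarith)
    have row : ∀ k : ℕ, (α - 1) * α ^ k ≤ (α - 1) * α → k ≤ 1 := fun k hk =>
      le_iff.1 (by rw [pow_one]; exact le_of_mul_le_mul_left hk (by linarith))
    have hjtop : j = m + 2 → i ≤ 1 := by
      rintro rfl
      rw [e2] at h3
      exact row i (by linarith)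
    have hitop : i = m + 2 → j ≤ 1 := by
      rintro rfl
      rw [e2] at h4
      exact row j (by linarith)
    have hjsub : j = m + 1 → m ≤ i := by
      rintro rfl
      rw [e1] at h5
      exact le_iff.1 (by rw [← hY]; linarith)
    have hisub : i = m + 1 → m ≤ j := by
      rintro rfl
      rw [e1] at h5
      exact le_iff.1 (by rw [← hY]; linarith)
    have hlow : ¬ (i ≤ m ∧ j ≤ m) := by
      rintro ⟨h6, h7⟩
      have h8 : α ^ i ≤ Y := hY ▸ le_iff.2 h6
      have h9 : α ^ j ≤ Y := hY ▸ le_iff.2 h7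
      nlinarith
    omega
  · simp only [Finset.mem_insert, Finset.mem_singleton, forall_eq_or_imp, forall_eq]
    -- The functional `-x - y` takes equal values at the last two vertices; a slight tilt either way
    -- exposes each of them.
    refine ⟨⟨-1, 0, ?_⟩, ⟨α - 1, 1, ?_⟩, ⟨1, 1, ?_⟩, ⟨1, α - 1, ?_⟩, ⟨0, -1, ?_⟩,
      ⟨-(α ^ 2 * Y - 1), -(α ^ 2 * Y), ?_⟩, ⟨-(α ^ 2 * Y), -(α ^ 2 * Y - 1), ?_⟩⟩ <;>
    · refine ⟨?_, ?_, ?_, ?_, ?_, ?_, ?_⟩ <;> intro hne <;>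
        first | exact absurd rfl hne | (simp only [pow_zero, pow_one, e1, e2, ← hY]; linarith)

theorem mainTheorem3 :
    (∀ α : ℝ, 2 ≤ α →
      maxEmptyVertices (expLattice α) = 5 ∧ hellyNumber (expLattice α) = 5) ∧
    (∀ α : ℝ, (1 + Real.sqrt 5) / 2 ≤ α → α < 2 →
      maxEmptyVertices (expLattice α) = 7 ∧ hellyNumber (expLattice α) = 7) ∧
    hellyNumber (expLattice 2) = 5 := by
  have five : ∀ α : ℝ, 2 ≤ α →
      maxEmptyVertices (expLattice α) = 5 ∧ hellyNumber (expLattice α) = 5 := by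
    intro α hα
    have hα1 : 1 < α := by linarith
    refine maxEmptyVertices_and_hellyNumber_eq (k := 5) (expLattice_inter_finite hα1) (by norm_num)
      (fun V hV => ?_) (exists_isEmptyVertexSet_five hα1)
    obtain ⟨W, hW, hcard⟩ := hV.exists_isEmptyExponents hα1
    rw [hcard]
    exact_mod_cast hW.card_le_five hα
  refine ⟨five, fun α hα hα2 => ?_, (five 2 le_rfl).2⟩
  have h5 : Real.sqrt 5 ^ 2 = 5 := Real.sq_sqrt (by norm_num)
  have h5' : 2 ≤ Real.sqrt 5 := Real.le_sqrt_of_sq_le (by norm_num)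
  have hα1 : 1 < α := by linarith
  have hα' : α + 1 ≤ α ^ 2 := by nlinarith
  refine maxEmptyVertices_and_hellyNumber_eq (k := 7) (expLattice_inter_finite hα1) (by norm_num)
    (fun V hV => ?_) (exists_isEmptyVertexSet_seven hα1 hα' hα2)
  obtain ⟨W, hW, hcard⟩ := hV.exists_isEmptyExponents hα1
  rw [hcard]
  exact_mod_cast hW.card_le_seven hα1 hα'

end ExpLattice
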